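/- A \emph{modal pseudocomplemented De Morgan algebra} ($mpM$-algebra) is an algebra $\langle A,\wedge,\vee,\sim,{}^*,0,1\rangle$ such that $\langle A,\wedge,\vee,0,1\rangle$ is a bounded distributive lattice, $\sim\sim x=x$ and $\sim(x\wedge y)=\sim x\vee\sim y$, $a^*$ is the pseudocomplement of $a$ (that is, $a\wedge x=0$ if and only if $x\le a^*$), and $x\vee\sim x\le x\vee x^*$. For an integer $k\ge 1$, a \emph{${\cal C}_k$-algebra} is a pair $(A,t)$ where $A$ is an $mpM$-algebra and $t$ is an automorphism of $A$ with $t^k(x)=x$ for all $x\in A$; it is regarded as an algebra with the operations $\wedge,\vee,\sim,{}^*,t,0,1$. Let $T_3=\{0,a,1\}$ be the $mpM$-algebra on the chain $0<a<1$ with $\sim a=a$, $a^*=0$, and let $T_4=\{0,a,b,1\}$ be the $mpM$-algebra on the four-element lattice with $a,b$ incomparable and $\sim a=a$, $\sim b=b$, $a^*=b$, $b^*=a$; in both, $\sim 0=0^*=1$ and $\sim 1=1^*=0$. For $i=3,4$ let $T_{i,k}=T_i^k$ with the pointwise operations and $t(x_1,\dots,x_k)=(x_k,x_1,\dots,x_{k-1})$.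 \textbf{Theorem.} Let $k\ge 1$ be an integer. The class of ${\cal C}_k$-algebras is a variety (closed under homomorphic images, subalgebras and direct products), which is finitely generated, i.e.\ it is the least variety containing some finite set of finite algebras, and locally finite, i.e.\ every finitely generated subalgebra of a ${\cal C}_k$-algebra is finite. Moreover, an algebra (of this type) is a simple ${\cal C}_k$-algebra if and only if it is isomorphic to a subalgebra of $(T_{3,k},t)$ or of $(T_{4,k},t)$ (these algebras themselves included), where an algebra is simple if it has more than one element and its only congruences are the identity and the total relation. -/

import Mathlib

universe u v

/-! ### Algebras of the type of modal pseudocomplemented De Morgan algebras -/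

/-- The operations of an `mpM`-algebra: `∧`, `∨`, `∼`, `*`, `0`, `1`. No laws are imposed. -/
class MpMOps (A : Type u) where
  meet : A → A → A
  join : A → A → A
  neg : A → A
  star : A → A
  zero : A
  one : A

/-- The operations of a `C_k`-algebra: those of an `mpM`-algebra and a further unary `t`.
No laws are imposed. -/
class CkOps (A : Type u) extends MpMOps A where
  t : A → A

open MpMOps CkOps

/-- The order of a lattice given by its operations: `x ≤ y` means `x ∧ y = x`. -/
def MpMOps.Le {A : Type u} [MpMOps A] (x y : A) : Prop := meet x y = x

/-- Modal pseudocomplemented De Morgan algebras. -/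
structure IsMpMAlgebra (A : Type u) [MpMOps A] : Prop where
  /- bounded distributive lattice -/
  meet_comm : ∀ x y : A, meet x y = meet y x
  join_comm : ∀ x y : A, join x y = join y x
  meet_assoc : ∀ x y z : A, meet (meet x y) z = meet x (meet y z)
  join_assoc : ∀ x y z : A, join (join x y) z = join x (join y z)
  meet_join_self : ∀ x y : A, meet x (join x y) = x
  join_meet_self : ∀ x y : A, join x (meet x y) = x
  meet_join_distrib : ∀ x y z : A, meet x (join y z) = join (meet x y) (meet x z)
  zero_le : ∀ x : A, Le zero x
  le_one : ∀ x : A, Le x one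
  /- De Morgan negation -/
  neg_neg : ∀ x : A, neg (neg x) = x
  neg_meet : ∀ x y : A, neg (meet x y) = join (neg x) (neg y)
  /- `star a` is the pseudocomplement of `a` -/
  star_iff : ∀ a x : A, meet a x = zero ↔ Le x (star a)
  /- the modal law `x ∨ ∼x ≤ x ∨ x*` -/
  tm : ∀ x : A, Le (join x (neg x)) (join x (star x))

/-- Homomorphisms of the type of `mpM`-algebras. -/
structure IsMpMHom {A : Type u} {B : Type v} [MpMOps A] [MpMOps B] (f : A → B) : Prop where
  map_meet : ∀ x y, f (meet x y) = meet (f x) (f y)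
  map_join : ∀ x y, f (join x y) = join (f x) (f y)
  map_neg : ∀ x, f (neg x) = neg (f x)
  map_star : ∀ x, f (star x) = star (f x)
  map_zero : f zero = zero
  map_one : f one = one

/-- `C_k`-algebras: `mpM`-algebras with an automorphism `t` such that `t^k = id`. -/
structure IsCkAlgebra (k : ℕ) (A : Type u) [CkOps A] : Prop where
  isMpM : IsMpMAlgebra A
  t_hom : IsMpMHom (t : A → A)
  t_bijective : Function.Bijective (t : A → A)
  t_iterate : ∀ x : A, t^[k] x = x

/-! ### Homomorphisms, subalgebras, products, congruences -/

/-- Homomorphisms of the type of `C_k`-algebras. -/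
structure IsCkHom {A : Type u} {B : Type v} [CkOps A] [CkOps B] (f : A → B) : Prop
    extends IsMpMHom f where
  map_t : ∀ x, f (t x) = t (f x)

/-- `A` and `B` are isomorphic. -/
def CkIsomorphic (A : Type u) (B : Type v) [CkOps A] [CkOps B] : Prop :=
  ∃ f : A → B, IsCkHom f ∧ Function.Bijective f

/-- Subalgebras: subsets closed under all operations (constants included). -/
structure CkSubalgebra (A : Type u) [CkOps A] where
  carrier : Set A
  meet_mem : ∀ {x y}, x ∈ carrier → y ∈ carrier → meet x y ∈ carrier
  join_mem : ∀ {x y}, x ∈ carrier → y ∈ carrier → join x y ∈ carrier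
  neg_mem : ∀ {x}, x ∈ carrier → neg x ∈ carrier
  star_mem : ∀ {x}, x ∈ carrier → star x ∈ carrier
  t_mem : ∀ {x}, x ∈ carrier → t x ∈ carrier
  zero_mem : zero ∈ carrier
  one_mem : one ∈ carrier

/-- A subalgebra with the restricted operations. -/
instance CkSubalgebra.instCkOps {A : Type u} [CkOps A] (S : CkSubalgebra A) :
    CkOps S.carrier where
  meet x y := ⟨meet x.1 y.1, S.meet_mem x.2 y.2⟩
  join x y := ⟨join x.1 y.1, S.join_mem x.2 y.2⟩
  neg x := ⟨neg x.1, S.neg_mem x.2⟩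
  star x := ⟨star x.1, S.star_mem x.2⟩
  zero := ⟨zero, S.zero_mem⟩
  one := ⟨one, S.one_mem⟩
  t x := ⟨t x.1, S.t_mem x.2⟩

/-- The universe of the subalgebra generated by a set. -/
def ckGenerated {A : Type u} [CkOps A] (X : Set A) : Set A :=
  {a | ∀ S : CkSubalgebra A, X ⊆ S.carrier → a ∈ S.carrier}

/-- Direct products, with pointwise operations. -/
instance piCkOps {ι : Type v} (F : ι → Type u) [∀ i, CkOps (F i)] : CkOps (∀ i, F i) where
  meet x y := fun i => meet (x i) (y i)
  join x y := fun i => join (x i) (y i)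
  neg x := fun i => neg (x i)
  star x := fun i => star (x i)
  zero := fun _ => zero
  one := fun _ => one
  t x := fun i => t (x i)

/-- Congruences: equivalence relations compatible with all operations. -/
structure IsCkCongruence {A : Type u} [CkOps A] (θ : Setoid A) : Prop where
  meet_congr : ∀ {x x' y y'}, θ x x' → θ y y' → θ (meet x y) (meet x' y')
  join_congr : ∀ {x x' y y'}, θ x x' → θ y y' → θ (join x y) (join x' y')
  neg_congr : ∀ {x x'}, θ x x' → θ (neg x) (neg x')
  star_congr : ∀ {x x'}, θ x x' → θ (star x) (star x')
  t_congr : ∀ {x x'}, θ x x' → θ (t x) (t x')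

/-- Simple algebras: nontrivial, and the only congruences are the identity and the total
relation. -/
def IsCkSimple (A : Type u) [CkOps A] : Prop :=
  Nontrivial A ∧ ∀ θ : Setoid A, IsCkCongruence θ → θ = ⊥ ∨ θ = ⊤

/-! ### Classes of algebras -/

/-- Algebras of the type of `C_k`-algebras (no laws). -/
structure CkTypeAlg where
  carrier : Type u
  [ops : CkOps carrier]

attribute [instance] CkTypeAlg.ops

/-- A variety: a class of algebras closed under homomorphic images, subalgebras and direct
products. -/
structure IsVariety (V : Set CkTypeAlg.{u}) : Prop where
  image_mem : ∀ A B : CkTypeAlg.{u}, A ∈ V →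
    (∃ f : A.carrier → B.carrier, IsCkHom f ∧ Function.Surjective f) → B ∈ V
  sub_mem : ∀ A : CkTypeAlg.{u}, A ∈ V → ∀ S : CkSubalgebra A.carrier,
    CkTypeAlg.mk S.carrier ∈ V
  prod_mem : ∀ (ι : Type u) (F : ι → CkTypeAlg.{u}), (∀ i, F i ∈ V) →
    CkTypeAlg.mk (∀ i, (F i).carrier) ∈ V

/-- The variety generated by a class `K`: the least variety containing `K`. -/
def generatedVariety (K : Set CkTypeAlg.{u}) : Set CkTypeAlg.{u} :=
  {A | ∀ V : Set CkTypeAlg.{u}, IsVariety V → K ⊆ V → A ∈ V}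

/-- A class is a finitely generated variety if it is the variety generated by a finite set of
finite algebras. -/
def IsFinitelyGeneratedVariety (V : Set CkTypeAlg.{u}) : Prop :=
  ∃ K : Set CkTypeAlg.{u}, K.Finite ∧ (∀ A ∈ K, Finite A.carrier) ∧ V = generatedVariety K

/-- A class is locally finite if in each of its members every finitely generated subalgebra
is finite. -/
def IsLocallyFiniteClass (V : Set CkTypeAlg.{u}) : Prop :=
  ∀ A ∈ V, ∀ X : Set A.carrier, X.Finite → (ckGenerated X).Finite

/-- The class of all `C_k`-algebras. -/
def ckAlgebras (k : ℕ) : Set CkTypeAlg.{u} := {A | IsCkAlgebra k A.carrier}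

/-! ### The algebras `T_{3,k}` and `T_{4,k}` -/

/-- The chain `0 < a < 1`. -/
inductive T3 : Type
  | zero | a | one

/-- The `mpM`-algebra `T_3`. -/
instance T3.instMpMOps : MpMOps T3 where
  meet
    | .zero, _ => .zero
    | .one, y => y
    | .a, .zero => .zero
    | .a, .a => .a
    | .a, .one => .a
  join
    | .zero, y => y
    | .one, _ => .one
    | .a, .zero => .a
    | .a, .a => .a
    | .a, .one => .one
  neg
    | .zero => .one
    | .a => .a
    | .one => .zero
  star
    | .zero => .one
    | .a => .zero
    | .one => .zero
  zero := .zero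
  one := .one

/-- The four-element lattice with incomparable `a`, `b` between `0` and `1`. -/
inductive T4 : Type
  | zero | a | b | one

/-- The `mpM`-algebra `T_4`. -/
instance T4.instMpMOps : MpMOps T4 where
  meet
    | .zero, _ => .zero
    | .one, y => y
    | .a, .zero => .zero
    | .a, .a => .a
    | .a, .b => .zero
    | .a, .one => .a
    | .b, .zero => .zero
    | .b, .a => .zero
    | .b, .b => .b
    | .b, .one => .b
  join
    | .zero, y => y
    | .one, _ => .one
    | .a, .zero => .a
    | .a, .a => .a
    | .a, .b => .one
    | .a, .one => .one
    | .b, .zero => .b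
    | .b, .a => .one
    | .b, .b => .b
    | .b, .one => .one
  neg
    | .zero => .one
    | .a => .a
    | .b => .b
    | .one => .zero
  star
    | .zero => .one
    | .a => .b
    | .b => .a
    | .one => .zero
  zero := .zero
  one := .one

/-- The set `T^k` of sequences of length `k`. -/
def CyclicPower (T : Type u) (k : ℕ) : Type u := Fin k → T

/-- `T^k` with pointwise operations and the cyclic shift
`t (x₁, …, x_k) = (x_k, x₁, …, x_{k-1})`. -/
instance CyclicPower.instCkOps (T : Type u) [MpMOps T] (k : ℕ) : CkOps (CyclicPower T k) where
  meet x y := fun i => meet (x i) (y i)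
  join x y := fun i => join (x i) (y i)
  neg x := fun i => neg (x i)
  star x := fun i => star (x i)
  zero := fun _ => zero
  one := fun _ => one
  t x := fun i => x ((finRotate k).symm i)

/-!
Distinct elements of an `mpM`-algebra are separated by a prime filter `P`. Let
`φ P = {x | ∼x ∉ P}`. The modal law forces the position of `P` relative to `φ P` to determine how
`*` acts on the classes of `P` and `φ P`: if one of the two contains the other, sending `x` to the
pair of truth values `(x ∈ P, ∼x ∈ P)` is a homomorphism to `T_3`, and if they are incomparable it
is a homomorphism to `T_4`. Since `T^k` with the cyclic shift is the cofree `C_k`-algebra on `T`,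
every `C_k`-algebra is separated by homomorphisms to `T_{3,k}` and `T_{4,k}`. This residual
property yields finite generation, local finiteness, and the embeddability of the simple algebras.

Conversely, `T_3` and `T_4` share a term which is the characteristic function of equality. On `T^k`
the meet of its orbit under `t` is again such a function, so that any nontrivial congruence on a
subalgebra of `T^k` identifies `0` with `1`.
-/

/-! ### Homomorphisms -/

namespace IsMpMHom

variable {A B C : Type*} [MpMOps A] [MpMOps B] [MpMOps C]

protected theorem id : IsMpMHom (id : A → A) :=
  ⟨fun _ _ => rfl, fun _ _ => rfl, fun _ => rfl, fun _ => rfl, rfl, rfl⟩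

theorem comp {g : B → C} {f : A → B} (hg : IsMpMHom g) (hf : IsMpMHom f) : IsMpMHom (g ∘ f) where
  map_meet x y := by simp only [Function.comp_apply, hf.map_meet, hg.map_meet]
  map_join x y := by simp only [Function.comp_apply, hf.map_join, hg.map_join]
  map_neg x := by simp only [Function.comp_apply, hf.map_neg, hg.map_neg]
  map_star x := by simp only [Function.comp_apply, hf.map_star, hg.map_star]
  map_zero := by simp only [Function.comp_apply, hf.map_zero, hg.map_zero]
  map_one := by simp only [Function.comp_apply, hf.map_one, hg.map_one]

theorem iterate {f : A → A} (hf : IsMpMHom f) : ∀ n : ℕ, IsMpMHom f^[n]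
  | 0 => .id
  | n + 1 => (hf.iterate n).comp hf

theorem of_comp_separating {ι : Type*} {D : ι → Type*} [∀ i, MpMOps (D i)] {f : ∀ i, B → D i}
    {g : A → B} (hf : ∀ i, IsMpMHom (f i)) (hfg : ∀ i, IsMpMHom (f i ∘ g))
    (hinj : Function.Injective fun x i => f i x) : IsMpMHom g where
  map_meet x y := hinj <| funext fun i =>
    ((hfg i).map_meet x y).trans ((hf i).map_meet _ _).symm
  map_join x y := hinj <| funext fun i =>
    ((hfg i).map_join x y).trans ((hf i).map_join _ _).symm
  map_neg x := hinj <| funext fun i => ((hfg i).map_neg x).trans ((hf i).map_neg _).symm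
  map_star x := hinj <| funext fun i => ((hfg i).map_star x).trans ((hf i).map_star _).symm
  map_zero := hinj <| funext fun i => (hfg i).map_zero.trans (hf i).map_zero.symm
  map_one := hinj <| funext fun i => (hfg i).map_one.trans (hf i).map_one.symm

theorem of_comp_surjective {g : B → C} {f : A → B} (hf : IsMpMHom f) (hgf : IsMpMHom (g ∘ f))
    (hsurj : Function.Surjective f) : IsMpMHom g where
  map_meet := hsurj.forall₂.2 fun x y => hf.map_meet x y ▸ hgf.map_meet x y
  map_join := hsurj.forall₂.2 fun x y => hf.map_join x y ▸ hgf.map_join x y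
  map_neg := hsurj.forall.2 fun x => hf.map_neg x ▸ hgf.map_neg x
  map_star := hsurj.forall.2 fun x => hf.map_star x ▸ hgf.map_star x
  map_zero := hf.map_zero ▸ hgf.map_zero
  map_one := hf.map_one ▸ hgf.map_one

end IsMpMHom

namespace IsCkHom

variable {A B C : Type*} [CkOps A] [CkOps B] [CkOps C]

protected theorem id : IsCkHom (id : A → A) :=
  ⟨.id, fun _ => rfl⟩

theorem comp {g : B → C} {f : A → B} (hg : IsCkHom g) (hf : IsCkHom f) : IsCkHom (g ∘ f) :=
  ⟨hg.toIsMpMHom.comp hf.toIsMpMHom, fun x => by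
    simp only [Function.comp_apply, hf.map_t, hg.map_t]⟩

theorem semiconj_t {f : A → B} (hf : IsCkHom f) : Function.Semiconj f t t :=
  hf.map_t

theorem map_iterate_t {f : A → B} (hf : IsCkHom f) (n : ℕ) (x : A) : f (t^[n] x) = t^[n] (f x) :=
  hf.semiconj_t.iterate_right n x

theorem of_comp_separating {ι : Type*} {D : ι → Type*} [∀ i, CkOps (D i)] {f : ∀ i, B → D i}
    {g : A → B} (hf : ∀ i, IsCkHom (f i)) (hfg : ∀ i, IsCkHom (f i ∘ g))
    (hinj : Function.Injective fun x i => f i x) : IsCkHom g :=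
  ⟨.of_comp_separating (fun i => (hf i).toIsMpMHom) (fun i => (hfg i).toIsMpMHom) hinj,
    fun x => hinj <| funext fun i => ((hfg i).map_t x).trans ((hf i).map_t _).symm⟩

theorem of_comp_injective {f : B → C} {g : A → B} (hf : IsCkHom f) (hfg : IsCkHom (f ∘ g))
    (hinj : Function.Injective f) : IsCkHom g :=
  of_comp_separating (fun _ : Unit => hf) (fun _ => hfg) fun _ _ h => hinj (congrFun h ())

end IsCkHom

theorem isCkHom_eval {ι : Type*} (F : ι → Type*) [∀ i, CkOps (F i)] (i : ι) :
    IsCkHom (Function.eval i : (∀ i, F i) → F i) :=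
  ⟨⟨fun _ _ => rfl, fun _ _ => rfl, fun _ => rfl, fun _ => rfl, rfl, rfl⟩, fun _ => rfl⟩

theorem IsCkHom.pi {A ι : Type*} {F : ι → Type*} [CkOps A] [∀ i, CkOps (F i)]
    {f : ∀ i, A → F i} (hf : ∀ i, IsCkHom (f i)) : IsCkHom fun x i => f i x :=
  .of_comp_separating (isCkHom_eval F) hf fun _ _ h => h

theorem CkSubalgebra.isCkHom_val {A : Type*} [CkOps A] (S : CkSubalgebra A) :
    IsCkHom (Subtype.val : S.carrier → A) :=
  ⟨⟨fun _ _ => rfl, fun _ _ => rfl, fun _ => rfl, fun _ => rfl, rfl, rfl⟩, fun _ => rfl⟩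

theorem CkIsomorphic.symm {A B : Type*} [CkOps A] [CkOps B] :
    CkIsomorphic A B → CkIsomorphic B A := by
  rintro ⟨f, hf, hbij⟩
  obtain ⟨g, hgf, hfg⟩ := Function.bijective_iff_has_inverse.1 hbij
  exact ⟨g, .of_comp_injective hf (hfg.comp_eq_id ▸ .id) hbij.1,
    Function.bijective_iff_has_inverse.2 ⟨f, hfg, hgf⟩⟩

section Range

variable {A B : Type*} [CkOps A] [CkOps B] {f g : A → B}

/-- The image of a homomorphism, as a subalgebra of its codomain. -/
def IsCkHom.range (hf : IsCkHom f) : CkSubalgebra B where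
  carrier := Set.range f
  meet_mem := by rintro _ _ ⟨x, rfl⟩ ⟨y, rfl⟩; exact ⟨_, hf.map_meet x y⟩
  join_mem := by rintro _ _ ⟨x, rfl⟩ ⟨y, rfl⟩; exact ⟨_, hf.map_join x y⟩
  neg_mem := by rintro _ ⟨x, rfl⟩; exact ⟨_, hf.map_neg x⟩
  star_mem := by rintro _ ⟨x, rfl⟩; exact ⟨_, hf.map_star x⟩
  t_mem := by rintro _ ⟨x, rfl⟩; exact ⟨_, hf.map_t x⟩
  zero_mem := ⟨_, hf.map_zero⟩
  one_mem := ⟨_, hf.map_one⟩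

theorem IsCkHom.ckIsomorphic_range (hf : IsCkHom f) (hinj : Function.Injective f) :
    CkIsomorphic A hf.range.carrier :=
  ⟨Set.rangeFactorization f,
    .of_comp_injective hf.range.isCkHom_val hf Subtype.val_injective,
    Set.rangeFactorization_injective.2 hinj, Set.rangeFactorization_surjective⟩

theorem exists_ckIsomorphic_subalgebra_iff :
    (∃ S : CkSubalgebra B, CkIsomorphic A S.carrier) ↔
      ∃ f : A → B, IsCkHom f ∧ Function.Injective f :=
  ⟨fun ⟨S, _, hf, hbij⟩ =>
      ⟨_, S.isCkHom_val.comp hf, Subtype.val_injective.comp hbij.injective⟩,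
    fun ⟨_, hf, hinj⟩ => ⟨hf.range, hf.ckIsomorphic_range hinj⟩⟩

/-- The subalgebra of the elements on which two homomorphisms agree. -/
def IsCkHom.equalizer (hf : IsCkHom f) (hg : IsCkHom g) : CkSubalgebra A where
  carrier := {x | f x = g x}
  meet_mem hx hy := by simp_all only [Set.mem_ofPred_eq, hf.map_meet, hg.map_meet]
  join_mem hx hy := by simp_all only [Set.mem_ofPred_eq, hf.map_join, hg.map_join]
  neg_mem hx := by simp_all only [Set.mem_ofPred_eq, hf.map_neg, hg.map_neg]
  star_mem hx := by simp_all only [Set.mem_ofPred_eq, hf.map_star, hg.map_star]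
  t_mem hx := by simp_all only [Set.mem_ofPred_eq, hf.map_t, hg.map_t]
  zero_mem := hf.map_zero.trans hg.map_zero.symm
  one_mem := hf.map_one.trans hg.map_one.symm

theorem IsCkHom.eqOn_ckGenerated (hf : IsCkHom f) (hg : IsCkHom g) {X : Set A}
    (h : Set.EqOn f g X) : Set.EqOn f g (ckGenerated X) :=
  fun _ ha => ha (hf.equalizer hg) h

theorem IsCkHom.isCkCongruence_ker (hf : IsCkHom f) : IsCkCongruence (Setoid.ker f) where
  meet_congr hx hy := by simp_all only [Setoid.ker_def, hf.map_meet]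
  join_congr hx hy := by simp_all only [Setoid.ker_def, hf.map_join]
  neg_congr hx := by simp_all only [Setoid.ker_def, hf.map_neg]
  star_congr hx := by simp_all only [Setoid.ker_def, hf.map_star]
  t_congr hx := by simp_all only [Setoid.ker_def, hf.map_t]

theorem IsCkSimple.injective (hA : IsCkSimple A) (hf : IsCkHom f) {a b : A} (hab : f a ≠ f b) :
    Function.Injective f := by
  refine Setoid.ker_eq_bot_iff.1 ((hA.2 _ hf.isCkCongruence_ker).resolve_right fun htop => hab ?_)
  exact Setoid.ker_def.1 (htop ▸ trivial)

end Range

/-! ### The variety of `C_k`-algebras -/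

namespace IsMpMAlgebra

variable {A : Type*} [MpMOps A]

theorem meet_self (hA : IsMpMAlgebra A) (x : A) : meet x x = x := by
  have h := hA.meet_join_self x (meet x x)
  rwa [hA.join_meet_self] at h

theorem meet_zero (hA : IsMpMAlgebra A) (x : A) : meet x zero = zero := by
  rw [hA.meet_comm]; exact hA.zero_le x

theorem one_meet (hA : IsMpMAlgebra A) (x : A) : meet one x = x := by
  rw [hA.meet_comm]; exact hA.le_one x

theorem neg_join (hA : IsMpMAlgebra A) (x y : A) : neg (join x y) = meet (neg x) (neg y) := by
  rw [← hA.neg_neg (meet (neg x) (neg y)), hA.neg_meet, hA.neg_neg, hA.neg_neg]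

theorem neg_zero (hA : IsMpMAlgebra A) : neg (zero : A) = one := by
  have one_le_neg_zero : meet one (neg zero) = (one : A) := by
    conv_lhs => rw [← hA.neg_neg one, ← hA.neg_join, hA.join_comm, ← hA.zero_le (neg one),
      hA.join_comm, hA.meet_comm, hA.join_meet_self, hA.neg_neg]
  rw [← hA.one_meet (neg zero), one_le_neg_zero]

theorem neg_one (hA : IsMpMAlgebra A) : neg (one : A) = zero := by
  rw [← hA.neg_zero, hA.neg_neg]

theorem meet_star_self (hA : IsMpMAlgebra A) (x : A) : meet x (star x) = zero :=
  (hA.star_iff x (star x)).2 (hA.meet_self _)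

theorem star_zero (hA : IsMpMAlgebra A) : star (zero : A) = one := by
  rw [← hA.one_meet (star zero)]
  exact (hA.star_iff zero one).1 (hA.zero_le one)

theorem meet_star_meet (hA : IsMpMAlgebra A) (x y : A) :
    meet x (star (meet x y)) = meet x (star y) := by
  have h₁ : Le (meet x (star (meet x y))) (star y) := by
    rw [← hA.star_iff, ← hA.meet_assoc, hA.meet_comm y x, hA.meet_star_self]
  have h₂ : Le (meet x (star y)) (star (meet x y)) := by
    rw [← hA.star_iff, hA.meet_comm x (star y), hA.meet_assoc, ← hA.meet_assoc y,
      hA.meet_star_self, hA.zero_le, hA.meet_zero]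
  unfold Le at h₁ h₂
  rw [hA.meet_assoc] at h₁ h₂
  rw [← h₁, hA.meet_comm (star (meet x y)), h₂]

theorem of_separating {ι : Type*} {B : ι → Type*} [∀ i, MpMOps (B i)] {f : ∀ i, A → B i}
    (hB : ∀ i, IsMpMAlgebra (B i)) (hf : ∀ i, IsMpMHom (f i))
    (hinj : Function.Injective fun x i => f i x) : IsMpMAlgebra A := by
  have eq_iff (x y : A) : x = y ↔ ∀ i, f i x = f i y := hinj.eq_iff.symm.trans funext_iff
  constructor <;> intros <;> simp only [Le, eq_iff, (hf _).map_meet, (hf _).map_join,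
    (hf _).map_neg, (hf _).map_star, (hf _).map_zero, (hf _).map_one]
  case meet_comm => exact fun i => (hB i).meet_comm _ _
  case join_comm => exact fun i => (hB i).join_comm _ _
  case meet_assoc => exact fun i => (hB i).meet_assoc _ _ _
  case join_assoc => exact fun i => (hB i).join_assoc _ _ _
  case meet_join_self => exact fun i => (hB i).meet_join_self _ _
  case join_meet_self => exact fun i => (hB i).join_meet_self _ _
  case meet_join_distrib => exact fun i => (hB i).meet_join_distrib _ _ _
  case zero_le => exact fun i => (hB i).zero_le _
  case le_one => exact fun i => (hB i).le_one _
  case neg_neg => exact fun i => (hB i).neg_neg _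
  case neg_meet => exact fun i => (hB i).neg_meet _ _
  case star_iff => exact forall_congr' fun i => (hB i).star_iff _ _
  case tm => exact fun i => (hB i).tm _

/-- The law of pseudocomplements is not an identity, but it is preserved by homomorphic images
because it follows from `x ∧ (a ∧ x)* = x ∧ a*`. -/
theorem map_meet_eq_zero_iff {B : Type*} [MpMOps B] {f : A → B} (hA : IsMpMAlgebra A)
    (hf : IsMpMHom f) (a x : A) : meet (f a) (f x) = zero ↔ Le (f x) (star (f a)) := by
  have key : meet (f x) (star (meet (f a) (f x))) = meet (f x) (star (f a)) := by
    simp only [← hf.map_meet, ← hf.map_star]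
    rw [hA.meet_comm a x, hA.meet_star_meet]
  constructor <;> intro h
  · rw [Le, ← key, h, ← hf.map_zero, ← hf.map_star, hA.star_zero, ← hf.map_meet, hA.le_one]
  · rw [← h, ← hf.map_star, ← hf.map_meet, ← hf.map_meet, hA.meet_comm x, ← hA.meet_assoc,
      hA.meet_star_self, hA.zero_le, hf.map_zero]

theorem of_surjective {B : Type*} [MpMOps B] {f : A → B} (hA : IsMpMAlgebra A)
    (hf : IsMpMHom f) (hsurj : Function.Surjective f) : IsMpMAlgebra B := by
  constructor
  case star_iff => exact hsurj.forall₂.2 (hA.map_meet_eq_zero_iff hf)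
  all_goals
    simp only [Le, hsurj.forall, ← hf.map_meet, ← hf.map_join, ← hf.map_neg, ← hf.map_star,
      ← hf.map_zero, ← hf.map_one]
    intros
    apply congrArg f
  case meet_comm => exact hA.meet_comm _ _
  case join_comm => exact hA.join_comm _ _
  case meet_assoc => exact hA.meet_assoc _ _ _
  case join_assoc => exact hA.join_assoc _ _ _
  case meet_join_self => exact hA.meet_join_self _ _
  case join_meet_self => exact hA.join_meet_self _ _
  case meet_join_distrib => exact hA.meet_join_distrib _ _ _
  case zero_le => exact hA.zero_le _
  case le_one => exact hA.le_one _
  case neg_neg => exact hA.neg_neg _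
  case neg_meet => exact hA.neg_meet _ _
  case tm => exact hA.tm _

end IsMpMAlgebra

namespace IsCkAlgebra

variable {k : ℕ} [NeZero k] {A B : Type*} [CkOps A] [CkOps B]

theorem of_iterate_eq (hA : IsMpMAlgebra A) (t_hom : IsMpMHom (t : A → A))
    (t_iterate : ∀ x : A, t^[k] x = x) : IsCkAlgebra k A where
  isMpM := hA
  t_hom := t_hom
  t_bijective := by
    have h := Function.bijOn_ptsOfPeriod (t : A → A) (NeZero.pos k)
    rwa [Set.eq_univ_of_forall (s := Function.ptsOfPeriod t k) t_iterate, Set.bijOn_univ] at h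
  t_iterate := t_iterate

theorem of_separating {ι : Type*} {D : ι → Type*} [∀ i, CkOps (D i)] {f : ∀ i, A → D i}
    (hD : ∀ i, IsCkAlgebra k (D i)) (hf : ∀ i, IsCkHom (f i))
    (hinj : Function.Injective fun x i => f i x) : IsCkAlgebra k A := by
  have hf' (i) : IsMpMHom (f i) := (hf i).toIsMpMHom
  refine .of_iterate_eq (.of_separating (fun i => (hD i).isMpM) hf' hinj)
    (.of_comp_separating hf' (fun i => ?_) hinj) fun x => hinj <| funext fun i => ?_
  · rw [(hf i).semiconj_t.comp_eq]
    exact (hD i).t_hom.comp (hf' i)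
  · exact ((hf i).map_iterate_t k x).trans ((hD i).t_iterate _)

theorem of_injective {f : A → B} (hB : IsCkAlgebra k B) (hf : IsCkHom f)
    (hinj : Function.Injective f) : IsCkAlgebra k A :=
  .of_separating (fun _ : Unit => hB) (fun _ => hf) fun _ _ h => hinj (congrFun h ())

theorem of_surjective {f : A → B} (hA : IsCkAlgebra k A) (hf : IsCkHom f)
    (hsurj : Function.Surjective f) : IsCkAlgebra k B := by
  refine .of_iterate_eq (hA.isMpM.of_surjective hf.toIsMpMHom hsurj)
    (.of_comp_surjective hf.toIsMpMHom ?_ hsurj) (hsurj.forall.2 fun x => ?_)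
  · rw [← hf.semiconj_t.comp_eq]
    exact hf.toIsMpMHom.comp hA.t_hom
  · rw [← hf.map_iterate_t, hA.t_iterate]

end IsCkAlgebra

theorem isVariety_ckAlgebras (k : ℕ) [NeZero k] : IsVariety (ckAlgebras.{u} k) where
  image_mem _ _ hA := fun ⟨_, hf, hsurj⟩ => IsCkAlgebra.of_surjective hA hf hsurj
  sub_mem _ hA S := IsCkAlgebra.of_injective hA S.isCkHom_val Subtype.val_injective
  prod_mem _ _ hF := IsCkAlgebra.of_separating hF (isCkHom_eval _) fun _ _ h => h

/-! ### Residual classes -/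

/-- `A` is residually in the class `K` if homomorphisms from `A` to members of `K` separate the
elements of `A`. The members of `K` may live in another universe than `A`. -/
def IsResiduallyIn (A : Type u) [CkOps A] (K : Set CkTypeAlg.{v}) : Prop :=
  ∀ ⦃a b : A⦄, a ≠ b → ∃ B ∈ K, ∃ f : A → B.carrier, IsCkHom f ∧ f a ≠ f b

theorem IsVariety.mem_of_isResiduallyIn {V K : Set CkTypeAlg.{u}} (hV : IsVariety V)
    (hKV : K ⊆ V) {A : CkTypeAlg.{u}} (hA : IsResiduallyIn A.carrier K) : A ∈ V := by
  choose B hBK f hf hne using fun p : {p : A.carrier × A.carrier // p.1 ≠ p.2} => hA p.2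
  have hhom : IsCkHom fun x p => f p x := .pi hf
  have hinj : Function.Injective fun x p => f p x := fun a b h => by
    by_contra hab
    exact hne ⟨(a, b), hab⟩ (congrFun h ⟨(a, b), hab⟩)
  obtain ⟨g, hg, hbij⟩ := (hhom.ckIsomorphic_range hinj).symm
  exact hV.image_mem _ _ (hV.sub_mem _ (hV.prod_mem _ B fun p => hKV (hBK p)) hhom.range)
    ⟨g, hg, hbij.surjective⟩

theorem IsVariety.eq_generatedVariety {V K : Set CkTypeAlg.{u}} (hV : IsVariety V)
    (hKV : K ⊆ V) (hres : ∀ A ∈ V, IsResiduallyIn A.carrier K) : V = generatedVariety K :=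
  Set.Subset.antisymm
    (fun A hA _ hW hKW => hW.mem_of_isResiduallyIn hKW (hres A hA)) fun _ hA => hA V hV hKV

theorem IsResiduallyIn.finite_ckGenerated {A : Type u} [CkOps A] {K : Set CkTypeAlg.{v}}
    (hA : IsResiduallyIn A K) (hK : K.Finite) (hfin : ∀ B ∈ K, Finite B.carrier) {X : Set A}
    (hX : X.Finite) : (ckGenerated X).Finite := by
  have := hK.to_subtype
  have := hX.to_subtype
  have (B : K) : Finite B.1.carrier := hfin B.1 B.2
  -- A homomorphism is determined on `ckGenerated X` by its restriction to `X`, so finitely many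
  -- homomorphisms, one for each extendable map `X → B`, already separate `ckGenerated X`.
  let I := {i : Σ B : K, X → B.1.carrier //
    ∃ f : A → i.1.1.carrier, IsCkHom f ∧ ∀ x : X, f x = i.2 x}
  choose f hf hfX using fun i : I => i.2
  refine Set.finite_coe_iff.1 <| Finite.of_injective
    (fun (a : ckGenerated X) (i : I) => f i a) fun a b hab => Subtype.ext ?_
  by_contra hne
  obtain ⟨B, hB, g, hg, hgab⟩ := hA hne
  let i : I := ⟨⟨⟨B, hB⟩, fun x => g x⟩, g, hg, fun _ => rfl⟩
  have hfg : Set.EqOn (f i) g (ckGenerated X) :=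
    (hf i).eqOn_ckGenerated hg fun x hx => hfX i ⟨x, hx⟩
  exact hgab (by rw [← hfg a.2, ← hfg b.2]; exact congrFun hab i)

theorem IsResiduallyIn.exists_embedding {A : Type u} [CkOps A] {K : Set CkTypeAlg.{v}}
    (hA : IsResiduallyIn A K) (hsimple : IsCkSimple A) :
    ∃ B ∈ K, ∃ f : A → B.carrier, IsCkHom f ∧ Function.Injective f := by
  obtain ⟨a, b, hab⟩ := hsimple.1
  obtain ⟨B, hB, f, hf, hne⟩ := hA hab
  exact ⟨B, hB, f, hf, hsimple.injective hf hne⟩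

instance uliftCkOps (A : Type v) [CkOps A] : CkOps (ULift.{u} A) where
  meet x y := ⟨meet x.down y.down⟩
  join x y := ⟨join x.down y.down⟩
  neg x := ⟨neg x.down⟩
  star x := ⟨star x.down⟩
  zero := ⟨zero⟩
  one := ⟨one⟩
  t x := ⟨t x.down⟩

/-- A copy of an algebra in a larger universe: `T_{3,k}` and `T_{4,k}` live in `Type`, whereas the
variety they are to generate consists of algebras in `Type u`. -/
def CkTypeAlg.ulift (B : CkTypeAlg.{v}) : CkTypeAlg.{max u v} :=
  ⟨ULift.{u} B.carrier⟩

theorem isCkHom_up (A : Type v) [CkOps A] : IsCkHom (ULift.up : A → ULift.{u} A) :=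
  ⟨⟨fun _ _ => rfl, fun _ _ => rfl, fun _ => rfl, fun _ => rfl, rfl, rfl⟩, fun _ => rfl⟩

theorem isCkHom_down (A : Type v) [CkOps A] : IsCkHom (ULift.down : ULift.{u} A → A) :=
  ⟨⟨fun _ _ => rfl, fun _ _ => rfl, fun _ => rfl, fun _ => rfl, rfl, rfl⟩, fun _ => rfl⟩

theorem IsResiduallyIn.image_ulift {A : Type*} [CkOps A] {K : Set CkTypeAlg.{v}}
    (hA : IsResiduallyIn A K) : IsResiduallyIn A (CkTypeAlg.ulift.{u} '' K) := fun a b hab => by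
  obtain ⟨B, hB, f, hf, hne⟩ := hA hab
  exact ⟨B.ulift, ⟨B, hB, rfl⟩, ULift.up ∘ f, (isCkHom_up _).comp hf,
    fun h => hne (ULift.up_injective h)⟩

/-! ### Prime filters -/

/-- Prime filters of the underlying bounded lattice; they are proper and nonempty. -/
structure IsPrimeFilter {A : Type*} [MpMOps A] (P : Set A) : Prop where
  meet_mem_iff : ∀ x y, meet x y ∈ P ↔ x ∈ P ∧ y ∈ P
  join_mem_iff : ∀ x y, join x y ∈ P ↔ x ∈ P ∨ y ∈ P
  zero_notMem : zero ∉ P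
  one_mem : one ∈ P

/-- The distributive lattice underlying an `mpM`-algebra, with `⊓ = meet` and `⊔ = join`; it gives
access to the prime ideal theorem. -/
abbrev IsMpMAlgebra.distribLattice {A : Type*} [MpMOps A] (hA : IsMpMAlgebra A) :
    DistribLattice A :=
  letI : Max A := ⟨join⟩
  letI : Min A := ⟨meet⟩
  letI : Lattice A := Lattice.mk' hA.join_comm hA.join_assoc hA.meet_comm hA.meet_assoc
    hA.join_meet_self hA.meet_join_self
  DistribLattice.ofInfSupLe fun x y z => (hA.meet_join_distrib x y z).le

section PrimeFilter

variable {A : Type*} [MpMOps A] {P : Set A}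

theorem IsMpMAlgebra.exists_isPrimeFilter_of_not_le (hA : IsMpMAlgebra A) {a b : A}
    (hab : ¬ Le a b) : ∃ P : Set A, IsPrimeFilter P ∧ a ∈ P ∧ b ∉ P := by
  let _ := hA.distribLattice
  have hdisj : Disjoint (Order.PFilter.principal a : Set A) (Order.Ideal.principal b : Set A) :=
    Set.disjoint_left.2 fun x hax hxb => hab <| inf_eq_left.2 <|
      (Order.PFilter.mem_principal.1 hax).trans (Order.Ideal.mem_principal.1 hxb)
  obtain ⟨J, hJ, hbJ, haJ⟩ := DistribLattice.prime_ideal_of_disjoint_filter_ideal hdisj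
  have ha : a ∉ J := Set.disjoint_left.1 haJ (Order.PFilter.mem_principal.2 le_rfl)
  have hb : b ∈ J := hbJ (Order.Ideal.mem_principal.2 le_rfl)
  refine ⟨{x | x ∉ J}, ⟨fun x y => ?_, fun x y => ?_, ?_, ?_⟩, ha, not_not.2 hb⟩
  · exact (not_congr ⟨hJ.mem_or_mem, fun h => h.elim (J.lower (inf_le_left : x ⊓ y ≤ x))
      (J.lower (inf_le_right : x ⊓ y ≤ y))⟩).trans not_or
  · exact (not_congr Order.Ideal.sup_mem_iff).trans not_and_or
  · exact not_not.2 (J.lower (inf_eq_left.1 (hA.zero_le b)) hb)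
  · exact fun h => ha (J.lower (inf_eq_left.1 (hA.le_one a)) h)

theorem IsMpMAlgebra.exists_isPrimeFilter_separating (hA : IsMpMAlgebra A) {a b : A}
    (hab : a ≠ b) : ∃ P : Set A, IsPrimeFilter P ∧ ¬ (a ∈ P ↔ b ∈ P) := by
  by_cases h : Le a b
  · have h' : ¬ Le b a := fun h' => hab <| by rw [← h, hA.meet_comm, h']
    obtain ⟨P, hP, hb, ha⟩ := hA.exists_isPrimeFilter_of_not_le h'
    exact ⟨P, hP, fun hiff => ha (hiff.2 hb)⟩
  · obtain ⟨P, hP, ha, hb⟩ := hA.exists_isPrimeFilter_of_not_le h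
    exact ⟨P, hP, fun hiff => hb (hiff.1 ha)⟩

/-- The Białynicki-Birula–Rasiowa transform `P ↦ {x | ∼x ∉ P}`, an involution of the set of prime
filters. -/
def rasiowa (P : Set A) : Set A := {x | neg x ∉ P}

theorem mem_rasiowa {x : A} : x ∈ rasiowa P ↔ neg x ∉ P := Iff.rfl

theorem neg_mem_rasiowa (hA : IsMpMAlgebra A) {x : A} : neg x ∈ rasiowa P ↔ x ∉ P := by
  rw [mem_rasiowa, hA.neg_neg]

theorem rasiowa_rasiowa (hA : IsMpMAlgebra A) : rasiowa (rasiowa P) = P :=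
  Set.ext fun x => by rw [mem_rasiowa, neg_mem_rasiowa hA, not_not]

namespace IsPrimeFilter

protected theorem rasiowa (hA : IsMpMAlgebra A) (hP : IsPrimeFilter P) :
    IsPrimeFilter (rasiowa P) where
  meet_mem_iff x y := by simp only [mem_rasiowa, hA.neg_meet, hP.join_mem_iff, not_or]
  join_mem_iff x y := by simp only [mem_rasiowa, hA.neg_join, hP.meet_mem_iff, not_and_or]
  zero_notMem := by rw [mem_rasiowa, hA.neg_zero, not_not]; exact hP.one_mem
  one_mem := by rw [mem_rasiowa, hA.neg_one]; exact hP.zero_notMem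

theorem star_notMem (hA : IsMpMAlgebra A) (hP : IsPrimeFilter P) {x : A} (hx : x ∈ P) :
    star x ∉ P := fun h =>
  hP.zero_notMem (hA.meet_star_self x ▸ (hP.meet_mem_iff _ _).2 ⟨hx, h⟩)

theorem star_mem (hA : IsMpMAlgebra A) (hP : IsPrimeFilter P) {x : A} (hx : x ∉ P)
    (hnx : neg x ∈ P) : star x ∈ P := by
  have h : meet (join x (neg x)) (join x (star x)) ∈ P := by
    rw [hA.tm, hP.join_mem_iff]; exact Or.inr hnx
  exact ((hP.join_mem_iff _ _).1 ((hP.meet_mem_iff _ _).1 h).2).resolve_left hx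

theorem neg_star_mem (hA : IsMpMAlgebra A) (hP : IsPrimeFilter P) {x : A} (hnx : neg x ∉ P) :
    neg (star x) ∈ P :=
  not_not.1 ((hP.rasiowa hA).star_notMem hA hnx)

theorem star_mem_iff_of_subset (hA : IsMpMAlgebra A) (hP : IsPrimeFilter P)
    (hle : P ⊆ rasiowa P) (x : A) : star x ∈ P ↔ neg x ∈ P := by
  constructor <;> intro h
  · by_contra hnx
    exact hle h (hP.neg_star_mem hA hnx)
  · exact hP.star_mem hA (fun hx => hle hx h) h

theorem neg_star_mem_iff_of_subset (hA : IsMpMAlgebra A) (hP : IsPrimeFilter P)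
    (hle : P ⊆ rasiowa P) (x : A) : neg (star x) ∈ P ↔ neg x ∉ P :=
  ⟨fun h hnx => hle ((hP.star_mem_iff_of_subset hA hle x).2 hnx) h, hP.neg_star_mem hA⟩

theorem star_mem_iff_of_not_subset (hA : IsMpMAlgebra A) (hP : IsPrimeFilter P)
    (hle : ¬ P ⊆ rasiowa P) (x : A) : star x ∈ P ↔ x ∉ P := by
  refine ⟨fun h hx => hP.star_notMem hA hx h, fun hx => ?_⟩
  obtain ⟨u, hu, hnu⟩ := Set.not_subset.1 hle
  have hstar : star (meet u x) ∈ P := hP.star_mem hA (fun h => hx ((hP.meet_mem_iff _ _).1 h).2)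
    (by rw [hA.neg_meet, hP.join_mem_iff]; exact Or.inl (not_not.1 hnu))
  have hmeet : meet u (star (meet u x)) ∈ P := (hP.meet_mem_iff _ _).2 ⟨hu, hstar⟩
  rw [hA.meet_star_meet] at hmeet
  exact ((hP.meet_mem_iff _ _).1 hmeet).2

theorem neg_star_mem_iff_of_not_subset (hA : IsMpMAlgebra A) (hP : IsPrimeFilter P)
    (hge : ¬ rasiowa P ⊆ P) (x : A) : neg (star x) ∈ P ↔ neg x ∉ P := by
  have hle : ¬ rasiowa P ⊆ rasiowa (rasiowa P) := by rwa [rasiowa_rasiowa hA]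
  have h := (hP.rasiowa hA).star_mem_iff_of_not_subset hA hle x
  rw [mem_rasiowa, mem_rasiowa] at h
  exact not_iff_not.1 h

end IsPrimeFilter

theorem IsMpMHom.of_isPrimeFilter {T : Type*} [MpMOps T] {F : Set T} {h : A → T}
    (hA : IsMpMAlgebra A) (hT : IsMpMAlgebra T) (hP : IsPrimeFilter P) (hF : IsPrimeFilter F)
    (hsep : ∀ x y : T, (x ∈ F ↔ y ∈ F) → (neg x ∈ F ↔ neg y ∈ F) → x = y)
    (mem : ∀ x, h x ∈ F ↔ x ∈ P) (neg_mem : ∀ x, neg (h x) ∈ F ↔ neg x ∈ P)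
    (star_mem : ∀ x, star (h x) ∈ F ↔ star x ∈ P)
    (neg_star_mem : ∀ x, neg (star (h x)) ∈ F ↔ neg (star x) ∈ P) : IsMpMHom h where
  map_meet x y := by
    apply hsep <;> simp only [hA.neg_meet, hT.neg_meet, hP.meet_mem_iff, hF.meet_mem_iff,
      hP.join_mem_iff, hF.join_mem_iff, mem, neg_mem]
  map_join x y := by
    apply hsep <;> simp only [hA.neg_join, hT.neg_join, hP.meet_mem_iff, hF.meet_mem_iff,
      hP.join_mem_iff, hF.join_mem_iff, mem, neg_mem]
  map_neg x := by apply hsep <;> simp only [hA.neg_neg, hT.neg_neg, mem, neg_mem]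
  map_star x := by apply hsep <;> simp only [mem, neg_mem, star_mem, neg_star_mem]
  map_zero := by
    apply hsep <;> simp only [hA.neg_zero, hT.neg_zero, mem, neg_mem, hP.one_mem, hF.one_mem,
      hP.zero_notMem, hF.zero_notMem]
  map_one := by
    apply hsep <;> simp only [hA.neg_one, hT.neg_one, mem, neg_mem, hP.one_mem, hF.one_mem,
      hP.zero_notMem, hF.zero_notMem]

end PrimeFilter

/-! ### The algebras `T_3` and `T_4` -/

instance : DecidableEq T3 := fun x y => by
  cases x <;> cases y <;> first | exact isTrue rfl | exact isFalse nofun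

instance : DecidableEq T4 := fun x y => by
  cases x <;> cases y <;> first | exact isTrue rfl | exact isFalse nofun

instance : Fintype T3 :=
  ⟨{.zero, .a, .one}, by rintro (_ | _ | _) <;> decide⟩

instance : Fintype T4 :=
  ⟨{.zero, .a, .b, .one}, by rintro (_ | _ | _ | _) <;> decide⟩

instance {A : Type*} [MpMOps A] [DecidableEq A] : DecidableRel (Le : A → A → Prop) :=
  fun x y => inferInstanceAs (Decidable (meet x y = x))

theorem isMpMAlgebra_T3 : IsMpMAlgebra T3 := by
  constructor <;> decide

theorem isMpMAlgebra_T4 : IsMpMAlgebra T4 := by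
  constructor <;> decide

theorem T3.isPrimeFilter_singleton_one : IsPrimeFilter {T3.one} := by
  constructor <;> simp only [Set.mem_singleton_iff] <;> decide

theorem T4.isPrimeFilter_pair_a_one : IsPrimeFilter {T4.a, T4.one} := by
  constructor <;> simp only [Set.mem_insert_iff, Set.mem_singleton_iff] <;> decide

theorem T3.singleton_one_subset_rasiowa : {T3.one} ⊆ rasiowa {T3.one} :=
  Set.singleton_subset_iff.2 (nofun : T3.zero ≠ T3.one)

theorem T4.not_pair_a_one_subset_rasiowa : ¬ {T4.a, T4.one} ⊆ rasiowa {T4.a, T4.one} :=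
  fun h => h (Or.inl rfl : T4.a ∈ _) (Or.inl rfl)

theorem T4.not_rasiowa_subset_pair_a_one : ¬ rasiowa {T4.a, T4.one} ⊆ {T4.a, T4.one} := by
  have hb : T4.b ∉ ({.a, .one} : Set T4) := by
    simp only [Set.mem_insert_iff, Set.mem_singleton_iff]; decide
  exact fun h => hb (h (mem_rasiowa.2 hb))

section ToT

variable {A : Type*} [MpMOps A] {P : Set A}

open Classical in
/-- The map to `T_3` that records whether `x ∈ P` and whether `∼x ∈ P`. It is intended for
`P ⊆ rasiowa P`, where `x` and `∼x` are never both in `P`. -/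
noncomputable def toT3 (P : Set A) (x : A) : T3 :=
  if x ∈ P then .one else if neg x ∈ P then .zero else .a

open Classical in
/-- The map to `T_4` that records whether `x ∈ P` and whether `∼x ∈ P`; the prime filter
`{a, 1}` of `T_4` is the one that pulls back to `P`. -/
noncomputable def toT4 (P : Set A) (x : A) : T4 :=
  if x ∈ P then (if neg x ∈ P then .a else .one) else if neg x ∈ P then .zero else .b

theorem toT3_mem_iff (x : A) : toT3 P x ∈ ({.one} : Set T3) ↔ x ∈ P := by
  unfold toT3; split_ifs <;> simp_all

theorem neg_toT3_mem_iff (hle : P ⊆ rasiowa P) (x : A) :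
    neg (toT3 P x) ∈ ({.one} : Set T3) ↔ neg x ∈ P := by
  have hx : x ∈ P → neg x ∉ P := fun hx => hle hx
  unfold toT3; split_ifs <;> simp_all [neg]

theorem toT4_mem_iff (x : A) : toT4 P x ∈ ({.a, .one} : Set T4) ↔ x ∈ P := by
  unfold toT4; split_ifs <;> simp_all

theorem neg_toT4_mem_iff (x : A) : neg (toT4 P x) ∈ ({.a, .one} : Set T4) ↔ neg x ∈ P := by
  unfold toT4; split_ifs <;> simp_all [neg]

theorem isMpMHom_toT3 (hA : IsMpMAlgebra A) (hP : IsPrimeFilter P) (hle : P ⊆ rasiowa P) :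
    IsMpMHom (toT3 P) := by
  have hF := T3.isPrimeFilter_singleton_one
  have hFle := T3.singleton_one_subset_rasiowa
  refine .of_isPrimeFilter hA isMpMAlgebra_T3 hP hF ?_ toT3_mem_iff (neg_toT3_mem_iff hle)
    (fun x => ?_) (fun x => ?_)
  · simp only [Set.mem_singleton_iff]; decide
  · rw [hF.star_mem_iff_of_subset isMpMAlgebra_T3 hFle, hP.star_mem_iff_of_subset hA hle,
      neg_toT3_mem_iff hle]
  · rw [hF.neg_star_mem_iff_of_subset isMpMAlgebra_T3 hFle,
      hP.neg_star_mem_iff_of_subset hA hle, neg_toT3_mem_iff hle]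

theorem isMpMHom_toT4 (hA : IsMpMAlgebra A) (hP : IsPrimeFilter P) (hle : ¬ P ⊆ rasiowa P)
    (hge : ¬ rasiowa P ⊆ P) : IsMpMHom (toT4 P) := by
  have hF := T4.isPrimeFilter_pair_a_one
  refine .of_isPrimeFilter hA isMpMAlgebra_T4 hP hF ?_ toT4_mem_iff neg_toT4_mem_iff
    (fun x => ?_) (fun x => ?_)
  · simp only [Set.mem_insert_iff, Set.mem_singleton_iff]; decide
  · rw [hF.star_mem_iff_of_not_subset isMpMAlgebra_T4 T4.not_pair_a_one_subset_rasiowa,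
      hP.star_mem_iff_of_not_subset hA hle, toT4_mem_iff]
  · rw [hF.neg_star_mem_iff_of_not_subset isMpMAlgebra_T4 T4.not_rasiowa_subset_pair_a_one,
      hP.neg_star_mem_iff_of_not_subset hA hge, neg_toT4_mem_iff]

theorem IsMpMAlgebra.exists_separating_hom (hA : IsMpMAlgebra A) {a b : A} (hab : a ≠ b) :
    (∃ h : A → T3, IsMpMHom h ∧ h a ≠ h b) ∨ ∃ h : A → T4, IsMpMHom h ∧ h a ≠ h b := by
  obtain ⟨P, hP, hsep⟩ := hA.exists_isPrimeFilter_separating hab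
  by_cases hle : P ⊆ rasiowa P
  · refine Or.inl ⟨toT3 P, isMpMHom_toT3 hA hP hle, fun h => hsep ?_⟩
    rw [← toT3_mem_iff a, h, toT3_mem_iff]
  by_cases hge : rasiowa P ⊆ P
  · have hle' : rasiowa P ⊆ rasiowa (rasiowa P) := by rwa [rasiowa_rasiowa hA]
    refine Or.inl ⟨toT3 (rasiowa P), isMpMHom_toT3 hA (hP.rasiowa hA) hle', fun h => hsep ?_⟩
    rw [← not_iff_not, ← neg_mem_rasiowa hA, ← neg_toT3_mem_iff hle', h, neg_toT3_mem_iff hle',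
      neg_mem_rasiowa hA]
  · refine Or.inr ⟨toT4 P, isMpMHom_toT4 hA hP hle hge, fun h => hsep ?_⟩
    rw [← toT4_mem_iff a, h, toT4_mem_iff]

end ToT

/-! ### Cyclic powers -/

namespace CyclicPower

instance {T : Type u} [Finite T] {k : ℕ} : Finite (CyclicPower T k) :=
  inferInstanceAs (Finite (Fin k → T))

variable {T : Type u} [MpMOps T] {k : ℕ}

theorem isMpMHom_eval (i : Fin k) : IsMpMHom fun x : CyclicPower T k => x i :=
  ⟨fun _ _ => rfl, fun _ _ => rfl, fun _ => rfl, fun _ => rfl, rfl, rfl⟩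

theorem isMpMHom_t : IsMpMHom (t : CyclicPower T k → CyclicPower T k) :=
  ⟨fun _ _ => rfl, fun _ _ => rfl, fun _ => rfl, fun _ => rfl, rfl, rfl⟩

theorem isMpMAlgebra (hT : IsMpMAlgebra T) : IsMpMAlgebra (CyclicPower T k) :=
  .of_separating (fun _ => hT) isMpMHom_eval fun _ _ h => h

variable [NeZero k]

open scoped Fin.CommRing

theorem t_apply (x : CyclicPower T k) (i : Fin k) : t x i = x (i - 1) :=
  congrArg x (finRotate_symm_apply i)

theorem iterate_t_apply (n : ℕ) (x : CyclicPower T k) (i : Fin k) :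
    (t^[n] x) i = x (i - (n : Fin k)) := by
  induction n generalizing i with
  | zero => rw [Function.iterate_zero_apply, Nat.cast_zero, sub_zero]
  | succ n ih => rw [Function.iterate_succ_apply', t_apply, ih, Nat.cast_succ, sub_sub, add_comm]

theorem isCkAlgebra (hT : IsMpMAlgebra T) : IsCkAlgebra k (CyclicPower T k) :=
  .of_iterate_eq (isMpMAlgebra hT) isMpMHom_t fun x => funext fun i => by
    rw [iterate_t_apply, Fin.natCast_self, sub_zero]

end CyclicPower

section CyclicLift

open scoped Fin.CommRing

variable {A T : Type*} [CkOps A] {k : ℕ} {h : A → T}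

/-- The map to the cyclic power induced by a map `h : A → T`: up to the direction of the shift, it
sends `x` to the values of `h` along the orbit of `x`. The exponent `-i` is what turns `t` on `A`
into the shift, and `h` is recovered as the coordinate `0`. -/
def cyclicLift (k : ℕ) (h : A → T) (x : A) : CyclicPower T k :=
  fun i => h (t^[(-i).val] x)

variable [NeZero k]

theorem cyclicLift_zero (x : A) : cyclicLift k h x 0 = h x := by
  rw [cyclicLift, neg_zero, Fin.val_zero, Function.iterate_zero_apply]

theorem IsCkAlgebra.iterate_val_add_one (hA : IsCkAlgebra k A) (i : Fin k) (x : A) :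
    t^[(i + 1).val] x = t^[i.val] (t x) := by
  have hx : Function.IsPeriodicPt t k x := hA.t_iterate x
  rw [Fin.val_add, Fin.val_one', Nat.add_mod_mod, hx.iterate_mod_apply,
    Function.iterate_succ_apply]

theorem IsCkAlgebra.isCkHom_cyclicLift [MpMOps T] (hA : IsCkAlgebra k A) (hh : IsMpMHom h) :
    IsCkHom (cyclicLift k h) where
  toIsMpMHom := .of_comp_separating CyclicPower.isMpMHom_eval
    (fun i => hh.comp (hA.t_hom.iterate (-i).val)) fun _ _ h => h
  map_t x := funext fun i => by
    rw [CyclicPower.t_apply, cyclicLift, cyclicLift, neg_sub', sub_neg_eq_add,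
      hA.iterate_val_add_one]

end CyclicLift

/-- The algebras `T_{3,k}` and `T_{4,k}`, which generate the variety of `C_k`-algebras. -/
def cyclicPowers (k : ℕ) : Set CkTypeAlg.{0} :=
  {⟨CyclicPower T3 k⟩, ⟨CyclicPower T4 k⟩}

section CyclicPowers

variable {k : ℕ}

theorem finite_cyclicPowers : (cyclicPowers k).Finite :=
  Set.toFinite {_, _}

theorem finite_of_mem_cyclicPowers : ∀ B ∈ cyclicPowers k, Finite B.carrier := by
  rintro _ (rfl | rfl)
  · exact inferInstanceAs (Finite (CyclicPower T3 k))
  · exact inferInstanceAs (Finite (CyclicPower T4 k))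

variable [NeZero k]

theorem isCkAlgebra_of_mem_cyclicPowers : ∀ B ∈ cyclicPowers k, IsCkAlgebra k B.carrier := by
  rintro _ (rfl | rfl)
  · exact CyclicPower.isCkAlgebra isMpMAlgebra_T3
  · exact CyclicPower.isCkAlgebra isMpMAlgebra_T4

theorem IsCkAlgebra.isResiduallyIn_cyclicPowers {A : Type u} [CkOps A] (hA : IsCkAlgebra k A) :
    IsResiduallyIn A (cyclicPowers k) := fun a b hab => by
  have lift_ne {T : Type} {h : A → T} (hne : h a ≠ h b) : cyclicLift k h a ≠ cyclicLift k h b :=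
    fun heq => hne <| by simpa only [cyclicLift_zero] using congrFun heq 0
  obtain ⟨h, hh, hne⟩ | ⟨h, hh, hne⟩ := hA.isMpM.exists_separating_hom hab
  · exact ⟨_, Or.inl rfl, cyclicLift k h, hA.isCkHom_cyclicLift hh, lift_ne hne⟩
  · exact ⟨_, Or.inr rfl, cyclicLift k h, hA.isCkHom_cyclicLift hh, lift_ne hne⟩

end CyclicPowers

theorem isFinitelyGeneratedVariety_ckAlgebras (k : ℕ) [NeZero k] :
    IsFinitelyGeneratedVariety (ckAlgebras.{u} k) := by
  refine ⟨CkTypeAlg.ulift '' cyclicPowers k, finite_cyclicPowers.image _, ?_,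
    (isVariety_ckAlgebras k).eq_generatedVariety ?_ fun A hA =>
      (IsCkAlgebra.isResiduallyIn_cyclicPowers hA).image_ulift⟩
  · rintro _ ⟨B, hB, rfl⟩
    have := finite_of_mem_cyclicPowers B hB
    exact inferInstanceAs (Finite (ULift B.carrier))
  · rintro _ ⟨B, hB, rfl⟩
    exact (isCkAlgebra_of_mem_cyclicPowers B hB).of_injective (isCkHom_down _)
      ULift.down_injective

theorem isLocallyFiniteClass_ckAlgebras (k : ℕ) [NeZero k] :
    IsLocallyFiniteClass (ckAlgebras.{u} k) := fun _ hA _ hX =>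
  (IsCkAlgebra.isResiduallyIn_cyclicPowers hA).finite_ckGenerated finite_cyclicPowers
    finite_of_mem_cyclicPowers hX

/-! ### Simple algebras -/

namespace MpMOps

variable {A : Type*} [MpMOps A]

/-- The necessity operator `x ∧ (∼x)*`. On `T_3` and `T_4` it sends `1` to `1` and every other
element to `0`. -/
def nec (x : A) : A := meet x (star (neg x))

/-- The possibility operator `∼□∼x`, the dual of `nec`. -/
def pos (x : A) : A := neg (nec (neg x))

/-- The term `(□(x ∧ y) ∨ ∼□(x ∨ y)) ∧ (◇(x ∧ y) ∨ ∼◇(x ∨ y))`, which is the characteristic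
function of equality on `T_3` and on `T_4`: there, comparable elements that agree under `□` and
under `◇` are equal (Moisil's determination principle), so `x = y` as soon as `x ∧ y` and `x ∨ y`
agree under both. -/
def eqTerm (x y : A) : A :=
  meet (join (nec (meet x y)) (neg (nec (join x y))))
    (join (pos (meet x y)) (neg (pos (join x y))))

end MpMOps

namespace CkOps

variable {A : Type*} [CkOps A]

/-- The finite meet `x ∧ t x ∧ ⋯ ∧ t^{n-1} x`. -/
def meetOrbit (x : A) : ℕ → A
  | 0 => one
  | n + 1 => meet (meetOrbit x n) (t^[n] x)

/-- The meet of the `t`-orbit of `eqTerm x y`, the characteristic function of equality on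
`T_{3,k}` and `T_{4,k}`. -/
def orbitEqTerm (k : ℕ) (x y : A) : A := meetOrbit (eqTerm x y) k

end CkOps

theorem IsMpMAlgebra.meetOrbit_le {A : Type*} [CkOps A] (hA : IsMpMAlgebra A) (x : A) {j n : ℕ}
    (hj : j < n) : Le (meetOrbit x n) (t^[j] x) := by
  induction n with
  | zero => exact absurd hj j.not_lt_zero
  | succ n ih =>
    unfold Le at ih ⊢
    rw [meetOrbit, hA.meet_assoc]
    obtain hj | rfl := Nat.lt_succ_iff_lt_or_eq.1 hj
    · rw [hA.meet_comm (t^[n] x), ← hA.meet_assoc, ih hj]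
    · rw [hA.meet_self]

theorem IsMpMAlgebra.meetOrbit_one {A : Type*} [CkOps A] (hA : IsMpMAlgebra A)
    (ht : t (one : A) = one) (n : ℕ) : meetOrbit (one : A) n = one := by
  induction n with
  | zero => rfl
  | succ n ih => rw [meetOrbit, ih, hA.one_meet, Function.iterate_fixed ht]

theorem IsMpMHom.map_eqTerm {A B : Type*} [MpMOps A] [MpMOps B] {f : A → B} (hf : IsMpMHom f)
    (x y : A) : f (eqTerm x y) = eqTerm (f x) (f y) := by
  simp only [eqTerm, pos, nec, hf.map_meet, hf.map_join, hf.map_neg, hf.map_star]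

theorem IsCkHom.map_orbitEqTerm {A B : Type*} [CkOps A] [CkOps B] {f : A → B} (hf : IsCkHom f)
    (k : ℕ) (x y : A) : f (orbitEqTerm k x y) = orbitEqTerm k (f x) (f y) := by
  have map_meetOrbit (z : A) (n : ℕ) : f (meetOrbit z n) = meetOrbit (f z) n := by
    induction n with
    | zero => exact hf.map_one
    | succ n ih => rw [meetOrbit, hf.map_meet, ih, hf.map_iterate_t, meetOrbit]
  rw [orbitEqTerm, map_meetOrbit, hf.map_eqTerm, orbitEqTerm]

namespace IsCkCongruence

variable {A : Type*} [CkOps A] {θ : Setoid A} {x y y' : A}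

theorem nec_congr (hθ : IsCkCongruence θ) (h : θ y y') : θ (nec y) (nec y') :=
  hθ.meet_congr h (hθ.star_congr (hθ.neg_congr h))

theorem pos_congr (hθ : IsCkCongruence θ) (h : θ y y') : θ (pos y) (pos y') :=
  hθ.neg_congr (hθ.nec_congr (hθ.neg_congr h))

theorem eqTerm_congr_right (hθ : IsCkCongruence θ) (h : θ y y') :
    θ (eqTerm x y) (eqTerm x y') := by
  have hmeet : θ (meet x y) (meet x y') := hθ.meet_congr (θ.refl x) h
  have hjoin : θ (join x y) (join x y') := hθ.join_congr (θ.refl x) h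
  exact hθ.meet_congr (hθ.join_congr (hθ.nec_congr hmeet) (hθ.neg_congr (hθ.nec_congr hjoin)))
    (hθ.join_congr (hθ.pos_congr hmeet) (hθ.neg_congr (hθ.pos_congr hjoin)))

theorem iterate_t_congr (hθ : IsCkCongruence θ) (h : θ y y') (n : ℕ) :
    θ (t^[n] y) (t^[n] y') := by
  induction n with
  | zero => exact h
  | succ n ih => simpa only [Function.iterate_succ_apply'] using hθ.t_congr ih

theorem meetOrbit_congr (hθ : IsCkCongruence θ) (h : θ y y') :
    ∀ n, θ (meetOrbit y n) (meetOrbit y' n)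
  | 0 => θ.refl one
  | n + 1 => hθ.meet_congr (hθ.meetOrbit_congr h n) (hθ.iterate_t_congr h n)

theorem eq_top_of_one_zero (hθ : IsCkCongruence θ) (hA : IsMpMAlgebra A)
    (h : θ (one : A) zero) : θ = ⊤ := by
  have rel_zero (z : A) : θ z zero := by
    have hz := hθ.meet_congr h (θ.refl z)
    rwa [hA.one_meet, hA.zero_le] at hz
  exact Setoid.eq_top_iff.2 fun x y => θ.trans (rel_zero x) (θ.symm (rel_zero y))

end IsCkCongruence

/-- `d` is the characteristic function of equality, with distinct truth values `0` and `1`. -/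
structure IsEqIndicator {A : Type*} [MpMOps A] (d : A → A → A) : Prop where
  zero_ne_one : (zero : A) ≠ one
  self : ∀ x, d x x = one
  of_ne : ∀ x y, x ≠ y → d x y = zero

theorem T3.isEqIndicator_eqTerm : IsEqIndicator (eqTerm : T3 → T3 → T3) := by
  constructor <;> decide

theorem T4.isEqIndicator_eqTerm : IsEqIndicator (eqTerm : T4 → T4 → T4) := by
  constructor <;> decide

theorem IsEqIndicator.comap {A B : Type*} [MpMOps A] [MpMOps B] {d : A → A → A} {e : B → B → B}
    {f : A → B} (he : IsEqIndicator e) (hf : IsMpMHom f) (hinj : Function.Injective f)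
    (hde : ∀ x y, f (d x y) = e (f x) (f y)) : IsEqIndicator d where
  zero_ne_one h := he.zero_ne_one <| by rw [← hf.map_zero, h, hf.map_one]
  self x := hinj <| by rw [hde, he.self, hf.map_one]
  of_ne x y h := hinj <| by rw [hde, he.of_ne _ _ (hinj.ne h), hf.map_zero]

theorem IsEqIndicator.isCkSimple {A : Type*} [CkOps A] {k : ℕ}
    (hd : IsEqIndicator (orbitEqTerm k : A → A → A)) (hA : IsMpMAlgebra A) : IsCkSimple A := by
  refine ⟨⟨_, _, hd.zero_ne_one⟩, fun θ hθ => or_iff_not_imp_left.2 fun hbot => ?_⟩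
  obtain ⟨x, y, hxy, hne⟩ : ∃ x y, θ x y ∧ x ≠ y := by
    contrapose! hbot
    exact Setoid.ext fun x y => ⟨hbot x y, by rintro rfl; exact θ.refl x⟩
  have h : θ (orbitEqTerm k x x) (orbitEqTerm k x y) :=
    hθ.meetOrbit_congr (hθ.eqTerm_congr_right hxy) k
  rw [hd.self, hd.of_ne x y hne] at h
  exact hθ.eq_top_of_one_zero hA h

open scoped Fin.CommRing in
theorem CyclicPower.isEqIndicator_orbitEqTerm {T : Type u} [MpMOps T] (hT : IsMpMAlgebra T)
    (he : IsEqIndicator (eqTerm : T → T → T)) (k : ℕ) [NeZero k] :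
    IsEqIndicator (orbitEqTerm k : CyclicPower T k → CyclicPower T k → CyclicPower T k) where
  zero_ne_one h := he.zero_ne_one (congrFun h 0)
  self x := by
    have hone : eqTerm x x = one := funext fun i =>
      ((isMpMHom_eval i).map_eqTerm x x).trans (he.self _)
    rw [orbitEqTerm, hone, (isMpMAlgebra hT).meetOrbit_one isMpMHom_t.map_one]
  of_ne x y hxy := by
    obtain ⟨j, hj⟩ := Function.ne_iff.1 hxy
    have hzero : eqTerm x y j = zero :=
      ((isMpMHom_eval j).map_eqTerm x y).trans (he.of_ne _ _ hj)
    refine funext fun i => ?_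
    -- the shift by `i - j` moves the coordinate `j` to `i`
    have hle : meet (orbitEqTerm k x y i) ((t^[(i - j).val] (eqTerm x y)) i) =
        orbitEqTerm k x y i :=
      congrFun ((isMpMAlgebra hT).meetOrbit_le (eqTerm x y) (i - j).isLt) i
    rw [iterate_t_apply, Fin.cast_val_eq_self, sub_sub_cancel, hzero, hT.meet_zero] at hle
    exact hle.symm

theorem isEqIndicator_of_mem_cyclicPowers {k : ℕ} [NeZero k] :
    ∀ B ∈ cyclicPowers k, IsEqIndicator (orbitEqTerm k : B.carrier → B.carrier → B.carrier) := by
  rintro _ (rfl | rfl)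
  · exact CyclicPower.isEqIndicator_orbitEqTerm isMpMAlgebra_T3 T3.isEqIndicator_eqTerm k
  · exact CyclicPower.isEqIndicator_orbitEqTerm isMpMAlgebra_T4 T4.isEqIndicator_eqTerm k

theorem isCkAlgebra_and_isCkSimple_iff_exists_embedding {k : ℕ} [NeZero k] {A : Type u}
    [CkOps A] : IsCkAlgebra k A ∧ IsCkSimple A ↔
      ∃ B ∈ cyclicPowers k, ∃ f : A → B.carrier, IsCkHom f ∧ Function.Injective f := by
  constructor
  · rintro ⟨hA, hsimple⟩
    exact hA.isResiduallyIn_cyclicPowers.exists_embedding hsimple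
  · rintro ⟨B, hB, f, hf, hinj⟩
    have hA : IsCkAlgebra k A := (isCkAlgebra_of_mem_cyclicPowers B hB).of_injective hf hinj
    have hd : IsEqIndicator (orbitEqTerm k : A → A → A) :=
      (isEqIndicator_of_mem_cyclicPowers B hB).comap hf.toIsMpMHom hinj (hf.map_orbitEqTerm k)
    exact ⟨hA, hd.isCkSimple hA.isMpM⟩

theorem mainTheorem2 (k : ℕ) (hk : 1 ≤ k) :
    IsVariety (ckAlgebras.{u} k) ∧
    IsFinitelyGeneratedVariety (ckAlgebras.{u} k) ∧
    IsLocallyFiniteClass (ckAlgebras.{u} k) ∧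
    ∀ (A : Type u) [CkOps A],
      (IsCkAlgebra k A ∧ IsCkSimple A) ↔
        ((∃ S : CkSubalgebra (CyclicPower T3 k), CkIsomorphic A S.carrier) ∨
          (∃ S : CkSubalgebra (CyclicPower T4 k), CkIsomorphic A S.carrier)) := by
  have : NeZero k := ⟨Nat.one_le_iff_ne_zero.1 hk⟩
  refine ⟨isVariety_ckAlgebras k, isFinitelyGeneratedVariety_ckAlgebras k,
    isLocallyFiniteClass_ckAlgebras k, fun A _ => ?_⟩
  simp only [isCkAlgebra_and_isCkSimple_iff_exists_embedding, exists_ckIsomorphic_subalgebra_iff,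
    cyclicPowers, Set.mem_insert_iff, Set.mem_singleton_iff, exists_eq_or_imp, exists_eq_left]
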